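/- Let $V$ be a finite-dimensional complex vector space and let $M=(m_{ij})_{0\le i,j\le 5}$ be a skew-symmetric $6\times 6$ matrix whose entries are linear forms $m_{ij}\in V^*$. For a $6\times 6$ matrix $F$ with entries $0$ and $*$ (blanks stand for $0$), say that a matrix of linear forms has form $F$ if its $(i,j)$ entry is $0$ whenever $F_{ij}=0$, and say that $M$ has skew format $F$ if there is $S\in \mathrm{GL}_6(\mathbb C)$ such that $SMS^t$ has form $F$. Say that $M$ has double skew format $F$ if there is $S\in\mathrm{GL}_6(\mathbb C)$ such that $SMS^t$ has form $F$ and moreover $SMS^t=\begin{pmatrix}N_0&N_1\\-N_1^t&N_2\end{pmatrix}$ with skew-symmetric $3\times3$ matrices of linear forms $N_0,N_1,N_2$. Suppose that $M$ has the skew format ("hammer format") $$\left(\begin{smallmatrix}0&*&*&*&*&*\\ *&0&*&*&*&*\\ *&*&0&*&*&*\\ *&*&*&0&0&0\\ *&*&*&0&0&0\\ *&*&*&0&0&0\end{smallmatrix}\right)$$ and that its Pfaffian $\mathrm{Pf}(M)\in \mathrm{Sym}^3(V^*)$ vanishes. Then $M$ has at least one of the skew formats $$(a)\ \left(\begin{smallmatrix}0&*&*&*&*&0\\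 *&0&*&*&*&0\\ *&*&0&*&*&0\\ *&*&*&0&*&0\\ *&*&*&*&0&0\\ 0&0&0&0&0&0\end{smallmatrix}\right),\quad (b)\ \left(\begin{smallmatrix}0&*&*&*&*&*\\ *&0&*&*&*&*\\ *&*&0&0&0&0\\ *&*&0&0&0&0\\ *&*&0&0&0&0\\ *&*&0&0&0&0\end{smallmatrix}\right),\quad (c)\ \left(\begin{smallmatrix}0&*&*&*&*&*\\ *&0&*&*&0&0\\ *&*&0&*&0&0\\ *&*&*&0&0&0\\ *&0&0&0&0&0\\ *&0&0&0&0&0\end{smallmatrix}\right),$$ or the double skew format $$(e)\ \left(\begin{smallmatrix}0&*&*&0&*&*\\ *&0&*&*&0&*\\ *&*&0&*&*&0\\ 0&*&*&0&0&0\\ *&0&*&0&0&0\\ *&*&0&0&0&0\end{smallmatrix}\right).$$ -/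

import Mathlib

namespace SkewFormats

open Matrix Module

/-- The entries of a format: `o` stands for `0` (or a blank), `x` stands for `*`. -/
inductive Slot : Type
  | o
  | x

section Matrices

variable {V : Type*} [AddCommGroup V] [Module ℂ V]

/-- A matrix of linear forms has form `F` if its entries vanish wherever `F` has a `0`. -/
def HasForm {r s : ℕ} (M : Matrix (Fin r) (Fin s) (Dual ℂ V))
    (F : Matrix (Fin r) (Fin s) Slot) : Prop :=
  ∀ i j, F i j = Slot.o → M i j = 0

/-- A matrix of linear forms is skew if `Mᵗ = -M`. -/
def IsSkew {r : ℕ} (M : Matrix (Fin r) (Fin r) (Dual ℂ V)) : Prop :=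
  Mᵀ = -M

/-- The product `S M Sᵗ` of a matrix `M` of linear forms with a matrix `S` of constants and its
transpose. -/
def congruent {r : ℕ} (S : Matrix (Fin r) (Fin r) ℂ) (M : Matrix (Fin r) (Fin r) (Dual ℂ V)) :
    Matrix (Fin r) (Fin r) (Dual ℂ V) :=
  Matrix.of fun i j => ∑ k, ∑ l, (S i k * S j l) • M k l

/-- The matrix `M` has skew format `F` if some `S M Sᵗ` with `S` invertible has form `F`. -/
def HasSkewFormat {r : ℕ} (M : Matrix (Fin r) (Fin r) (Dual ℂ V))
    (F : Matrix (Fin r) (Fin r) Slot) : Prop :=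
  IsSkew M ∧ ∃ S : GL (Fin r) ℂ, HasForm (congruent (S : Matrix (Fin r) (Fin r) ℂ) M) F

/-- A `6 × 6` matrix of linear forms is double skew if it consists of four `3 × 3` blocks
`N₀, N₁, -N₁ᵗ, N₂` with `N₀, N₁, N₂` skew. -/
def IsDoubleSkew (M : Matrix (Fin 6) (Fin 6) (Dual ℂ V)) : Prop :=
  ∃ N₀ N₁ N₂ : Matrix (Fin 3) (Fin 3) (Dual ℂ V), IsSkew N₀ ∧ IsSkew N₁ ∧ IsSkew N₂ ∧
    M = (Matrix.fromBlocks N₀ N₁ (-N₁ᵀ) N₂).reindex finSumFinEquiv finSumFinEquiv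

/-- The skew matrix `M` has double skew format `F` if some `S M Sᵗ` with `S` invertible is double
skew and has form `F`. -/
def HasDoubleSkewFormat (M : Matrix (Fin 6) (Fin 6) (Dual ℂ V))
    (F : Matrix (Fin 6) (Fin 6) Slot) : Prop :=
  IsSkew M ∧ ∃ S : GL (Fin 6) ℂ,
    IsDoubleSkew (congruent (S : Matrix (Fin 6) (Fin 6) ℂ) M) ∧
      HasForm (congruent (S : Matrix (Fin 6) (Fin 6) ℂ) M) F

end Matrices

/-- The Pfaffian of a skew-symmetric `2n × 2n` matrix over a commutative ring, by Laplace expansion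
along the first row: `Pf M = ∑ j ≥ 1, (-1) ^ (j + 1) * m₀ⱼ * Pf M₀ⱼ`, where `M₀ⱼ` arises from `M` by
deleting rows and columns `0` and `j`. Below, the summation index is `j - 1`. -/
def pfaffian {R : Type*} [CommRing R] : (n : ℕ) → Matrix (Fin (2 * n)) (Fin (2 * n)) R → R
  | 0, _ => 1
  | n + 1, M => ∑ j : Fin (2 * n + 1), (-1) ^ (j : ℕ) * M 0 j.succ *
      pfaffian n (M.submatrix (fun k => (j.succAbove k).succ) (fun k => (j.succAbove k).succ))

/-- The Pfaffian of a `6 × 6` matrix of linear forms on `V`, a cubic form on `V`, as an element of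
the symmetric algebra of the dual space, which is the ring of polynomial functions on `V`. -/
noncomputable def formPfaffian {V : Type*} [AddCommGroup V] [Module ℂ V]
    (M : Matrix (Fin 6) (Fin 6) (Dual ℂ V)) : SymmetricAlgebra ℂ (Dual ℂ V) :=
  pfaffian 3 (M.map (SymmetricAlgebra.ι ℂ (Dual ℂ V)))

open Slot in
/-- Hammer format. -/
def hammerFormat : Matrix (Fin 6) (Fin 6) Slot :=
  !![o, x, x, x, x, x;
     x, o, x, x, x, x;
     x, x, o, x, x, x;
     x, x, x, o, o, o;
     x, x, x, o, o, o;
     x, x, x, o, o, o]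

open Slot in
/-- Format (a). -/
def formatA : Matrix (Fin 6) (Fin 6) Slot :=
  !![o, x, x, x, x, o;
     x, o, x, x, x, o;
     x, x, o, x, x, o;
     x, x, x, o, x, o;
     x, x, x, x, o, o;
     o, o, o, o, o, o]

open Slot in
/-- Format (b). -/
def formatB : Matrix (Fin 6) (Fin 6) Slot :=
  !![o, x, x, x, x, x;
     x, o, x, x, x, x;
     x, x, o, o, o, o;
     x, x, o, o, o, o;
     x, x, o, o, o, o;
     x, x, o, o, o, o]

open Slot in
/-- Format (c). -/
def formatC : Matrix (Fin 6) (Fin 6) Slot :=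
  !![o, x, x, x, x, x;
     x, o, x, x, o, o;
     x, x, o, x, o, o;
     x, x, x, o, o, o;
     x, o, o, o, o, o;
     x, o, o, o, o, o]

open Slot in
/-- Format (e), to be used as a double skew format. -/
def formatE : Matrix (Fin 6) (Fin 6) Slot :=
  !![o, x, x, o, x, x;
     x, o, x, x, o, x;
     x, x, o, x, x, o;
     o, x, x, o, o, o;
     x, o, x, o, o, o;
     x, x, o, o, o, o]

end SkewFormats

namespace SkewFormats

open Matrix Module

/-! ### The determinant is the square of the Pfaffian -/

theorem det_literal_eq {R : Type*} [CommRing R] (a b c d e f g h i j k l m n o : R) :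
    (!![0, a, b, c, d, e; -a, 0, f, g, h, i; -b, -f, 0, j, k, l; -c, -g, -j, 0, m, n;
        -d, -h, -k, -m, 0, o; -e, -i, -l, -n, -o, 0]).det =
      (a * (j * o - k * n + l * m) - b * (g * o - h * n + i * m) + c * (f * o - h * l + i * k)
        - d * (f * n - g * l + i * j) + e * (f * m - g * k + h * j)) ^ 2 := by
  simp [Matrix.det_succ_row_zero, Fin.sum_univ_succ, Fin.succAbove, Matrix.submatrix_apply]
  ring

theorem pfaffian_literal_eq {R : Type*} [CommRing R] (a b c d e f g h i j k l m n o : R) :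
    pfaffian 3 (!![0, a, b, c, d, e; -a, 0, f, g, h, i; -b, -f, 0, j, k, l; -c, -g, -j, 0, m, n;
        -d, -h, -k, -m, 0, o; -e, -i, -l, -n, -o, 0]) =
      a * (j * o - k * n + l * m) - b * (g * o - h * n + i * m) + c * (f * o - h * l + i * k)
        - d * (f * n - g * l + i * j) + e * (f * m - g * k + h * j) := by
  simp [pfaffian, Fin.sum_univ_succ, Fin.succAbove]
  ring

/-- The determinant of an alternating `6 × 6` matrix is the square of its Pfaffian. -/
theorem det_eq_pfaffian_sq {R : Type*} [CommRing R] (N : Matrix (Fin (2 * 3)) (Fin (2 * 3)) R)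
    (hdiag : ∀ i, N i i = 0) (hskew : ∀ i j, N j i = -N i j) : N.det = pfaffian 3 N ^ 2 := by
  have hN : N = !![0, N 0 1, N 0 2, N 0 3, N 0 4, N 0 5;
      -N 0 1, 0, N 1 2, N 1 3, N 1 4, N 1 5;
      -N 0 2, -N 1 2, 0, N 2 3, N 2 4, N 2 5;
      -N 0 3, -N 1 3, -N 2 3, 0, N 3 4, N 3 5;
      -N 0 4, -N 1 4, -N 2 4, -N 3 4, 0, N 4 5;
      -N 0 5, -N 1 5, -N 2 5, -N 3 5, -N 4 5, 0] := by
    ext i j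
    fin_cases i <;> fin_cases j <;> first | exact hdiag _ | exact hskew _ _ | rfl
  rw [hN, pfaffian_literal_eq]
  exact det_literal_eq _ _ _ _ _ _ _ _ _ _ _ _ _ _ _

/-! ### Products of linear forms -/

section LinearForms

variable {V : Type*} [AddCommGroup V] [Module ℂ V]

theorem exists_apply_mul_apply_ne_zero {f g : Dual ℂ V} (hf : f ≠ 0) (hg : g ≠ 0) :
    ∃ v, f v * g v ≠ 0 := by
  by_contra! h
  obtain ⟨u, hu⟩ : ∃ u, f u ≠ 0 := by
    by_contra! H
    exact hf (LinearMap.ext H)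
  obtain ⟨w, hw⟩ : ∃ w, g w ≠ 0 := by
    by_contra! H
    exact hg (LinearMap.ext H)
  have h1 : g u = 0 := (mul_eq_zero.mp (h u)).resolve_left hu
  have h2 : f w = 0 := (mul_eq_zero.mp (h w)).resolve_right hw
  have h3 := h (u + w)
  simp [h1, h2, hu, hw] at h3

/-- If the product of three linear forms vanishes, then so does one of the factors. -/
theorem eq_zero_of_apply_mul_apply_mul_apply {f g h : Dual ℂ V}
    (H : ∀ v, f v * g v * h v = 0) (hf : f ≠ 0) (hg : g ≠ 0) : h = 0 := by
  obtain ⟨u, hu⟩ := exists_apply_mul_apply_ne_zero hf hg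
  have hu0 : h u = 0 := (mul_eq_zero.mp (H u)).resolve_left hu
  ext w
  by_contra hw
  have hw : h w ≠ 0 := hw
  have key : ∀ t : ℂ, t ≠ 0 → (f u + t * f w) * (g u + t * g w) = 0 := by
    intro t ht
    have := H (u + t • w)
    simp only [map_add, map_smul, smul_eq_mul, hu0, zero_add] at this
    exact (mul_eq_zero.mp this).resolve_right (mul_ne_zero ht hw)
  have k1 := key 1 (by norm_num)
  have k2 := key (-1) (by norm_num)
  have k3 := key 2 (by norm_num)
  apply hu
  linear_combination k1 + (1 / 3 : ℂ) * k2 - (1 / 3 : ℂ) * k3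

theorem eq_zero_of_apply_mul_apply {f g : Dual ℂ V} (H : ∀ v, f v * g v = 0) (hf : f ≠ 0) :
    g = 0 := by
  by_contra hg
  obtain ⟨v, hv⟩ := exists_apply_mul_apply_ne_zero hf hg
  exact hv (H v)

/-- Two linearly independent linear forms are part of a coordinate system. -/
theorem exists_dual_pair {f g : Dual ℂ V} (hf : f ≠ 0) (hg : ∀ c : ℂ, g ≠ c • f) :
    ∃ w u, f w = 1 ∧ g w = 0 ∧ f u = 0 ∧ g u = 1 := by
  obtain ⟨a, ha⟩ : ∃ a, f a ≠ 0 := by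
    by_contra! H
    exact hf (LinearMap.ext H)
  obtain ⟨x, hx⟩ : ∃ x, g x ≠ (g a / f a) * f x := by
    by_contra! H
    exact hg (g a / f a) (LinearMap.ext H)
  have hy : g x - g a / f a * f x ≠ 0 := sub_ne_zero.mpr hx
  set u : V := (g x - g a / f a * f x)⁻¹ • (x - (f x / f a) • a) with hu
  have hfu : f u = 0 := by
    simp only [hu, map_smul, map_sub, smul_eq_mul]
    field_simp
    ring
  have hgu : g u = 1 := by
    simp only [hu, map_smul, map_sub, smul_eq_mul]
    rw [show f x / f a * g a = g a / f a * f x by ring]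
    exact inv_mul_cancel₀ hy
  refine ⟨(f a)⁻¹ • (a - g a • u), u, ?_, ?_, hfu, hgu⟩
  · simp [hfu, ha]
  · simp [hgu]

end LinearForms

/-! ### Linear spaces of singular `3 × 3` matrices -/

section Singular

variable {V : Type*}

/-- The matrices `B v` have a common zero column, a common zero row or a common `2 × 2` block of
zeros, or all of them are skew. -/
def IsSingularNormalForm (B : V → Matrix (Fin 3) (Fin 3) ℂ) : Prop :=
  (∀ v i, B v i 2 = 0) ∨ (∀ v j, B v 2 j = 0) ∨
    (∀ v, B v 1 1 = 0 ∧ B v 1 2 = 0 ∧ B v 2 1 = 0 ∧ B v 2 2 = 0) ∨ ∀ v, (B v)ᵀ = -B v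

/-- After a common change of bases in source and target, the matrices `B v` are in normal form. -/
def HasSingularNormalForm (B : V → Matrix (Fin 3) (Fin 3) ℂ) : Prop :=
  ∃ P Q : Matrix (Fin 3) (Fin 3) ℂ, IsUnit P.det ∧ IsUnit Q.det ∧
    IsSingularNormalForm fun v => P * B v * Q

theorem HasSingularNormalForm.of_mul {B : V → Matrix (Fin 3) (Fin 3) ℂ}
    {P Q : Matrix (Fin 3) (Fin 3) ℂ} (hP : IsUnit P.det) (hQ : IsUnit Q.det)
    (h : HasSingularNormalForm fun v => P * B v * Q) : HasSingularNormalForm B := by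
  obtain ⟨P', Q', hP', hQ', h⟩ := h
  refine ⟨P' * P, Q * Q', ?_, ?_, ?_⟩
  · rw [det_mul]; exact hP'.mul hP
  · rw [det_mul]; exact hQ.mul hQ'
  · simpa only [Matrix.mul_assoc] using h

/-- Every singular `3 × 3` matrix is equivalent to a diagonal matrix of rank at most two. -/
theorem exists_mul_mul_eq_diagonal {N : Matrix (Fin 3) (Fin 3) ℂ} (hN : N.det = 0) :
    ∃ P Q : Matrix (Fin 3) (Fin 3) ℂ, IsUnit P.det ∧ IsUnit Q.det ∧
      (P * N * Q = diagonal ![1, 1, 0] ∨ P * N * Q = diagonal ![1, 0, 0] ∨ P * N * Q = 0) := by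
  obtain ⟨L, L', D, hD⟩ := Pivot.exists_list_transvec_mul_mul_list_transvec_eq_diagonal N
  set P₀ := (L.map TransvectionStruct.toMatrix).prod with hP₀
  set Q₀ := (L'.map TransvectionStruct.toMatrix).prod with hQ₀
  have dP : P₀.det = 1 := TransvectionStruct.det_toMatrix_prod L
  have dQ : Q₀.det = 1 := TransvectionStruct.det_toMatrix_prod L'
  have hprod : D 0 * D 1 * D 2 = 0 := by
    have := congrArg det hD
    rw [det_mul, det_mul, hN, det_diagonal, Fin.prod_univ_three] at this
    simpa using this.symm
  suffices H : ∃ P Q : Matrix (Fin 3) (Fin 3) ℂ, IsUnit P.det ∧ IsUnit Q.det ∧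
      (P * diagonal D * Q = diagonal ![1, 1, 0] ∨ P * diagonal D * Q = diagonal ![1, 0, 0] ∨
        P * diagonal D * Q = 0) by
    obtain ⟨P, Q, hP, hQ, h⟩ := H
    refine ⟨P * P₀, Q₀ * Q, ?_, ?_, ?_⟩
    · rwa [det_mul, dP, mul_one]
    · rwa [det_mul, dQ, one_mul]
    · rw [show P * P₀ * N * (Q₀ * Q) = P * (P₀ * N * Q₀) * Q by simp only [Matrix.mul_assoc], hD]
      exact h
  have hdiag : diagonal D = !![D 0, 0, 0; 0, D 1, 0; 0, 0, D 2] := by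
    ext i j
    fin_cases i <;> fin_cases j <;> rfl
  rw [hdiag]
  generalize D 0 = x at *
  generalize D 1 = y at *
  generalize D 2 = z at *
  by_cases hx : x = 0 <;> by_cases hy : y = 0 <;> by_cases hz : z = 0
  · exact ⟨1, 1, by simp, by simp, Or.inr (Or.inr (by
      ext i j; fin_cases i <;> fin_cases j <;> simp [hx, hy, hz]))⟩
  · refine ⟨!![0, 0, z⁻¹; 0, 1, 0; 1, 0, 0], !![0, 0, 1; 0, 1, 0; 1, 0, 0], ?_, ?_, ?_⟩
    · simp [det_fin_three, hz]
    · simp [det_fin_three]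
    · refine Or.inr (Or.inl ?_)
      ext i j
      fin_cases i <;> fin_cases j <;>
        simp [Matrix.mul_apply, Fin.sum_univ_three, hx, hy, hz]
  · refine ⟨!![0, y⁻¹, 0; 1, 0, 0; 0, 0, 1], !![0, 1, 0; 1, 0, 0; 0, 0, 1], ?_, ?_, ?_⟩
    · simp [det_fin_three, hy]
    · simp [det_fin_three]
    · refine Or.inr (Or.inl ?_)
      ext i j
      fin_cases i <;> fin_cases j <;>
        simp [Matrix.mul_apply, Fin.sum_univ_three, hx, hy, hz]
  · refine ⟨!![0, y⁻¹, 0; 0, 0, z⁻¹; 1, 0, 0], !![0, 0, 1; 1, 0, 0; 0, 1, 0], ?_, ?_, ?_⟩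
    · simp [det_fin_three, hy, hz]
    · simp [det_fin_three]
    · refine Or.inl ?_
      ext i j
      fin_cases i <;> fin_cases j <;>
        simp [Matrix.mul_apply, Fin.sum_univ_three, hx, hy, hz]
  · refine ⟨!![x⁻¹, 0, 0; 0, 1, 0; 0, 0, 1], 1, ?_, ?_, ?_⟩
    · simp [det_fin_three, hx]
    · simp
    · refine Or.inr (Or.inl ?_)
      ext i j
      fin_cases i <;> fin_cases j <;>
        simp [Matrix.mul_apply, Fin.sum_univ_three, hx, hy, hz]
  · refine ⟨!![x⁻¹, 0, 0; 0, 0, z⁻¹; 0, 1, 0], !![1, 0, 0; 0, 0, 1; 0, 1, 0], ?_, ?_, ?_⟩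
    · simp [det_fin_three, hx, hz]
    · simp [det_fin_three]
    · refine Or.inl ?_
      ext i j
      fin_cases i <;> fin_cases j <;>
        simp [Matrix.mul_apply, Fin.sum_univ_three, hx, hy, hz]
  · refine ⟨!![x⁻¹, 0, 0; 0, y⁻¹, 0; 0, 0, 1], 1, ?_, ?_, ?_⟩
    · simp [det_fin_three, hx, hy]
    · simp
    · refine Or.inl ?_
      ext i j
      fin_cases i <;> fin_cases j <;>
        simp [Matrix.mul_apply, Fin.sum_univ_three, hx, hy, hz]
  · simp [hx, hy, hz] at hprod

variable [AddCommGroup V] [Module ℂ V]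

/-- The case of a linear space of matrices of rank at most two which contains `diag(1, 1, 0)`. -/
theorem hasSingularNormalForm_of_rank_two (B : V →ₗ[ℂ] Matrix (Fin 3) (Fin 3) ℂ)
    (hdet : ∀ v, (B v).det = 0) (v₀ : V) (hv₀ : B v₀ = diagonal ![1, 1, 0]) :
    HasSingularNormalForm fun v => B v := by
  have h22 : ∀ v, B v 2 2 = 0 := by
    intro v
    have e1 := hdet (v + v₀)
    have e2 := hdet (v - v₀)
    have e0 := hdet v
    simp only [map_add, map_sub, hv₀, det_fin_three, Matrix.add_apply,
      Matrix.sub_apply] at e1 e2 e0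
    simp at e1 e2
    linear_combination (1 / 2 : ℂ) * e1 + (1 / 2 : ℂ) * e2 - e0
  have hcb : ∀ v, B v 2 0 * B v 0 2 + B v 2 1 * B v 1 2 = 0 := by
    intro v
    have e1 := hdet (v + v₀)
    have e2 := hdet (v - v₀)
    simp only [map_add, map_sub, hv₀, det_fin_three, Matrix.add_apply,
      Matrix.sub_apply] at e1 e2
    simp [h22] at e1 e2
    linear_combination (-1 / 2 : ℂ) * e1 + (1 / 2 : ℂ) * e2
  have hcXb : ∀ v, B v 2 0 * (B v 0 0 * B v 0 2 + B v 0 1 * B v 1 2) +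
      B v 2 1 * (B v 1 0 * B v 0 2 + B v 1 1 * B v 1 2) = 0 := by
    intro v
    have e0 := hdet v
    simp only [det_fin_three, h22] at e0
    linear_combination e0 + (B v 0 0 + B v 1 1) * hcb v
  let β : Fin 3 → Fin 3 → Dual ℂ V := fun i j => entryLinearMap ℂ ℂ i j ∘ₗ B
  have hβ : ∀ i j v, β i j v = B v i j := fun _ _ _ => rfl
  have hβ0 : ∀ {i j}, β i j = 0 → ∀ v, B v i j = 0 := fun h v => by rw [← hβ, h]; rfl
  by_cases hb0 : β 0 2 = 0
  · by_cases hb1 : β 1 2 = 0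
    · refine ⟨1, 1, by simp, by simp, Or.inl fun v i => ?_⟩
      fin_cases i <;> simp [hβ0 hb0 v, hβ0 hb1 v, h22 v]
    · have hc1 : β 2 1 = 0 := eq_zero_of_apply_mul_apply (f := β 1 2) (fun v => by
        have := hcb v
        rw [hβ0 hb0 v] at this
        rw [hβ, hβ]
        linear_combination this) hb1
      by_cases hc0 : β 2 0 = 0
      · refine ⟨1, 1, by simp, by simp, Or.inr (Or.inl fun v j => ?_)⟩
        fin_cases j <;> simp [hβ0 hc0 v, hβ0 hc1 v, h22 v]
      have h01 : β 0 1 = 0 := eq_zero_of_apply_mul_apply_mul_apply (f := β 1 2) (g := β 2 0)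
        (fun v => by
          have := hcXb v
          rw [hβ0 hb0 v, hβ0 hc1 v] at this
          rw [hβ, hβ, hβ]
          linear_combination this) hb1 hc0
      refine ⟨!![0, 1, 0; 1, 0, 0; 0, 0, 1], 1, by simp [det_fin_three], by simp,
        Or.inr (Or.inr (Or.inl fun v => ?_))⟩
      simp only [Matrix.mul_apply, Fin.sum_univ_three]
      simp [hβ0 hb0 v, hβ0 hc1 v, hβ0 h01 v, h22 v]
  by_cases hdep : ∃ μ : ℂ, β 1 2 = μ • β 0 2
  · obtain ⟨μ, hμ⟩ := hdep
    have hμ : ∀ v, B v 1 2 = μ * B v 0 2 := fun v => by rw [← hβ, hμ]; rfl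
    have hc0 : β 2 0 + μ • β 2 1 = 0 := eq_zero_of_apply_mul_apply (f := β 0 2) (fun v => by
      have := hcb v
      rw [hμ] at this
      simp only [LinearMap.add_apply, LinearMap.smul_apply, smul_eq_mul, hβ]
      linear_combination this) hb0
    have hc0 : ∀ v, B v 2 0 = -(μ * B v 2 1) := fun v => by
      have := LinearMap.congr_fun hc0 v
      simp only [LinearMap.add_apply, LinearMap.smul_apply, smul_eq_mul, hβ,
        LinearMap.zero_apply] at this
      linear_combination this
    by_cases hc1 : β 2 1 = 0
    · refine ⟨1, 1, by simp, by simp, Or.inr (Or.inl fun v j => ?_)⟩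
      fin_cases j <;> simp [hc0 v, hβ0 hc1 v, h22 v]
    have hX : β 1 0 + μ • β 1 1 - μ • β 0 0 - (μ * μ) • β 0 1 = 0 :=
      eq_zero_of_apply_mul_apply_mul_apply (f := β 0 2) (g := β 2 1) (fun v => by
        have := hcXb v
        rw [hμ, hc0] at this
        simp only [LinearMap.add_apply, LinearMap.sub_apply, LinearMap.smul_apply, smul_eq_mul, hβ]
        linear_combination this) hb0 hc1
    refine ⟨!![1, 0, 0; -μ, 1, 0; 0, 0, 1], !![0, 1, 0; 1, μ, 0; 0, 0, 1],
      by simp [det_fin_three], by simp [det_fin_three], Or.inr (Or.inr (Or.inl fun v => ?_))⟩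
    have hXv := LinearMap.congr_fun hX v
    simp only [LinearMap.add_apply, LinearMap.sub_apply, LinearMap.smul_apply, smul_eq_mul, hβ,
      LinearMap.zero_apply] at hXv
    simp only [Matrix.mul_apply, Fin.sum_univ_three]
    simp [hc0 v, hμ v, h22 v]
    constructor
    · linear_combination hXv
    · ring
  push Not at hdep
  obtain ⟨w, u, hw0, hw1, hu0, hu1⟩ := exists_dual_pair hb0 hdep
  simp only [hβ] at hw0 hw1 hu0 hu1
  have hb1 : β 1 2 ≠ 0 := fun h => by simp [hβ0 h u] at hu1
  have hc1u : B u 2 1 = 0 := by simpa [hu0, hu1] using hcb u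
  have hc0w : B w 2 0 = 0 := by simpa [hw0, hw1] using hcb w
  set l := B u 2 0 with hl
  have hc1 : ∀ v, B v 2 1 = -(l * B v 0 2) := fun v => by
    have h1 := hcb (v + u)
    have h2 := hcb v
    simp only [map_add, Matrix.add_apply, hu0, hu1, hc1u, ← hl] at h1
    linear_combination h1 - h2
  have hc0 : ∀ v, B v 2 0 = l * B v 1 2 := fun v => by
    have h1 := hcb (v + w)
    have h2 := hcb v
    simp only [map_add, Matrix.add_apply, hw0, hw1, hc0w] at h1
    have h3 := hc1 w
    rw [hw0] at h3
    linear_combination h1 - h2 - B v 1 2 * h3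
  by_cases hl0 : l = 0
  · refine ⟨1, 1, by simp, by simp, Or.inr (Or.inl fun v j => ?_)⟩
    fin_cases j <;> simp [hc0 v, hc1 v, hl0, h22 v]
  have hK : ∀ v, B v 1 2 * (B v 0 0 * B v 0 2 + B v 0 1 * B v 1 2) -
      B v 0 2 * (B v 1 0 * B v 0 2 + B v 1 1 * B v 1 2) = 0 := fun v => by
    have := hcXb v
    rw [hc0, hc1] at this
    refine (mul_eq_zero.mp (?_ : l * _ = 0)).resolve_left hl0
    linear_combination this
  have h01 : ∀ v, B v 0 1 = B w 0 1 * B v 0 2 := fun v => by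
    have h1 := hK u
    have h2 := hK (v - B v 0 2 • w + (1 - B v 1 2) • u)
    simp only [map_add, map_sub, map_smul, Matrix.add_apply, Matrix.sub_apply, Matrix.smul_apply,
      smul_eq_mul, hu0, hu1, hw0, hw1] at h1 h2
    ring_nf at h1 h2
    linear_combination h2 - (1 - B v 1 2) * h1
  have h10 : ∀ v, B v 1 0 = B u 1 0 * B v 1 2 := fun v => by
    have h1 := hK w
    have h2 := hK (v - B v 1 2 • u + (1 - B v 0 2) • w)
    simp only [map_add, map_sub, map_smul, Matrix.add_apply, Matrix.sub_apply, Matrix.smul_apply,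
      smul_eq_mul, hu0, hu1, hw0, hw1] at h1 h2
    ring_nf at h1 h2
    linear_combination -h2 + (1 - B v 0 2) * h1
  set s := B w 0 1
  set t := B u 1 0
  have hD : β 0 0 - β 1 1 + s • β 1 2 - t • β 0 2 = 0 :=
    eq_zero_of_apply_mul_apply_mul_apply (f := β 0 2) (g := β 1 2) (fun v => by
      have := hK v
      rw [h01, h10] at this
      simp only [LinearMap.add_apply, LinearMap.sub_apply, LinearMap.smul_apply, smul_eq_mul, hβ]
      linear_combination this) hb0 hb1
  refine ⟨!![1, 0, 0; 0, 1, 0; 0, 0, l⁻¹], !![0, -1, 0; 1, 0, 0; -s, t, 1],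
    by simp [det_fin_three, hl0], by simp [det_fin_three], Or.inr (Or.inr (Or.inr fun v => ?_))⟩
  have hDv := LinearMap.congr_fun hD v
  simp only [LinearMap.add_apply, LinearMap.sub_apply, LinearMap.smul_apply, smul_eq_mul, hβ,
    LinearMap.zero_apply] at hDv
  have hX : B v 0 0 = B v 1 1 - s * B v 1 2 + t * B v 0 2 := by linear_combination hDv
  ext i j
  simp only [transpose_apply, Matrix.neg_apply, Matrix.mul_apply, Fin.sum_univ_three]
  fin_cases i <;> fin_cases j <;> simp [hc0 v, hc1 v, h22 v, h01 v, h10 v, hX, hl0] <;> ring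

/-- The case of a linear space of matrices of rank at most one. -/
theorem hasSingularNormalForm_of_rank_one (B : V →ₗ[ℂ] Matrix (Fin 3) (Fin 3) ℂ)
    (hminor : ∀ v i j k l, B v i j * B v k l = B v i l * B v k j) (v₀ : V)
    (hv₀ : B v₀ = diagonal ![1, 0, 0]) : HasSingularNormalForm fun v => B v := by
  have h : ∀ v i j, i ≠ 0 → j ≠ 0 → B v i j = 0 := by
    intro v i j hi hj
    have e0 := hminor v 0 0 i j
    have e1 := hminor (v + v₀) 0 0 i j
    simp [hv₀, diagonal_apply, hj.symm] at e1
    have h0 : (![1, 0, 0] : Fin 3 → ℂ) i = 0 := by fin_cases i <;> simp_all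
    simp only [h0, ite_self, add_zero] at e1
    linear_combination e1 - e0
  exact ⟨1, 1, by simp, by simp, Or.inr (Or.inr (Or.inl fun v => by simp [h]))⟩

/-- A linear space of singular `3 × 3` matrices has a common zero column, a common zero row or a
common `2 × 2` block of zeros, or consists of skew matrices, after a common change of bases. -/
theorem hasSingularNormalForm_of_det_eq_zero (B : V →ₗ[ℂ] Matrix (Fin 3) (Fin 3) ℂ)
    (hdet : ∀ v, (B v).det = 0) : HasSingularNormalForm fun v => B v := by
  have hlin : ∀ P Q : Matrix (Fin 3) (Fin 3) ℂ, ∃ B' : V →ₗ[ℂ] Matrix (Fin 3) (Fin 3) ℂ,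
      ∀ v, B' v = P * B v * Q := fun P Q =>
    ⟨LinearMap.mulRight ℂ Q ∘ₗ LinearMap.mulLeft ℂ P ∘ₗ B, fun v => rfl⟩
  by_cases h2 : ∃ v, ∃ P Q : Matrix (Fin 3) (Fin 3) ℂ, IsUnit P.det ∧ IsUnit Q.det ∧
      P * B v * Q = diagonal ![1, 1, 0]
  · obtain ⟨v₀, P, Q, hP, hQ, hv₀⟩ := h2
    obtain ⟨B', hB'⟩ := hlin P Q
    refine HasSingularNormalForm.of_mul hP hQ ?_
    simp only [← hB'] at hv₀ ⊢
    exact hasSingularNormalForm_of_rank_two B' (fun v => by rw [hB', det_mul, det_mul, hdet]; simp)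
      v₀ hv₀
  have h1 : ∀ v, ∃ x y : Fin 3 → ℂ, B v = vecMulVec x y := by
    intro v
    obtain ⟨P, Q, hP, hQ, h⟩ := exists_mul_mul_eq_diagonal (hdet v)
    have hB : B v = P⁻¹ * (P * B v * Q) * Q⁻¹ := by
      rw [Matrix.mul_assoc P, nonsing_inv_mul_cancel_left _ _ hP, mul_nonsing_inv_cancel_right _ _ hQ]
    rcases h with h | h | h
    · exact absurd ⟨v, P, Q, hP, hQ, h⟩ h2
    · refine ⟨fun i => P⁻¹ i 0, fun j => Q⁻¹ 0 j, ?_⟩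
      rw [hB, h]
      ext i j
      simp [Matrix.mul_apply, vecMulVec_apply, Fin.sum_univ_three, diagonal_apply]
    · exact ⟨0, 0, by rw [hB, h]; simp⟩
  by_cases hz : ∀ v, B v = 0
  · exact ⟨1, 1, by simp, by simp, Or.inl fun v i => by simp [hz]⟩
  push Not at hz
  obtain ⟨v₀, hv₀⟩ := hz
  obtain ⟨P, Q, hP, hQ, h⟩ := exists_mul_mul_eq_diagonal (hdet v₀)
  obtain ⟨B', hB'⟩ := hlin P Q
  refine HasSingularNormalForm.of_mul hP hQ ?_
  rcases h with h | h | h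
  · exact absurd ⟨v₀, P, Q, hP, hQ, h⟩ h2
  · simp only [← hB'] at h ⊢
    refine hasSingularNormalForm_of_rank_one B' (fun v i j k l => ?_) v₀ h
    obtain ⟨x, y, hxy⟩ := h1 v
    rw [hB', hxy, mul_vecMulVec, vecMulVec_mul]
    simp only [vecMulVec_apply]
    ring
  · refine absurd ?_ hv₀
    rw [← mul_nonsing_inv_cancel_right (A := Q) (B v₀) hQ,
      ← nonsing_inv_mul_cancel_left (A := P) (B v₀) hP, Matrix.mul_assoc P⁻¹, h]
    simp

end Singular

/-! ### Congruence of matrices of linear forms -/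

section Congruence

variable {V : Type*} [AddCommGroup V] [Module ℂ V]

/-- The value of a matrix of linear forms at a vector. -/
def evalAt {r s : ℕ} (M : Matrix (Fin r) (Fin s) (Dual ℂ V)) (v : V) :
    Matrix (Fin r) (Fin s) ℂ :=
  M.map fun f => f v

theorem evalAt_congruent {r : ℕ} (S : Matrix (Fin r) (Fin r) ℂ)
    (M : Matrix (Fin r) (Fin r) (Dual ℂ V)) (v : V) :
    evalAt (congruent S M) v = S * evalAt M v * Sᵀ := by
  ext i j
  simp only [evalAt, congruent, Matrix.map_apply, of_apply, Matrix.mul_apply, transpose_apply,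
    LinearMap.sum_apply, LinearMap.smul_apply, smul_eq_mul, Finset.sum_mul]
  rw [Finset.sum_comm]
  refine Finset.sum_congr rfl fun l _ => Finset.sum_congr rfl fun k _ => ?_
  ring

theorem IsSkew.evalAt {r : ℕ} {M : Matrix (Fin r) (Fin r) (Dual ℂ V)} (h : IsSkew M) (v : V) :
    (evalAt M v)ᵀ = -evalAt M v := by
  ext i j
  exact LinearMap.congr_fun (congrFun (congrFun h i) j) v

theorem isSkew_of_evalAt {r : ℕ} {M : Matrix (Fin r) (Fin r) (Dual ℂ V)}
    (h : ∀ v, (SkewFormats.evalAt M v)ᵀ = -SkewFormats.evalAt M v) : IsSkew M := by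
  ext i j v
  exact congrFun (congrFun (h v) i) j

/-- A skew matrix of linear forms with vanishing Pfaffian is singular at each vector. -/
theorem det_evalAt_eq_zero {M : Matrix (Fin 6) (Fin 6) (Dual ℂ V)} (hskew : IsSkew M)
    (hpf : formPfaffian M = 0) (v : V) : (evalAt M v).det = 0 := by
  have hmap : ∀ {R R' : Type _} [CommRing R] [CommRing R'] (φ : R →+* R') (n : ℕ)
      (N : Matrix (Fin (2 * n)) (Fin (2 * n)) R), φ (pfaffian n N) = pfaffian n (N.map φ) := by
    intro R R' _ _ φ n
    induction n with
    | zero => intro N; simp [pfaffian]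
    | succ n ih => intro N; simp [pfaffian, ih, Matrix.submatrix_map]
  let φ : SymmetricAlgebra ℂ (Dual ℂ V) →ₐ[ℂ] ℂ := SymmetricAlgebra.lift (Dual.eval ℂ V v)
  have hφ : pfaffian 3 (evalAt M v) = 0 := by
    have := congrArg φ hpf
    rw [map_zero, formPfaffian] at this
    rw [← this]
    refine Eq.trans ?_ (hmap (φ : SymmetricAlgebra ℂ (Dual ℂ V) →+* ℂ) 3 _).symm
    congr 1
    ext i j
    simp [evalAt, φ]
  have hs := hskew.evalAt v
  have hs' : ∀ i j, evalAt M v j i = -evalAt M v i j := fun i j => congrFun (congrFun hs i) j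
  have := det_eq_pfaffian_sq (evalAt M v) (fun i => by linear_combination (1 / 2 : ℂ) * hs' i i) hs'
  exact this.trans (by rw [hφ]; simp)

end Congruence

/-! ### Block matrices -/

section Blocks

/-- The skew `6 × 6` matrix with given upper blocks and lower right block zero. -/
def hammer (X A : Matrix (Fin 3) (Fin 3) ℂ) : Matrix (Fin 6) (Fin 6) ℂ :=
  (fromBlocks X A (-Aᵀ) 0).reindex finSumFinEquiv finSumFinEquiv

/-- The block diagonal `6 × 6` matrix with given blocks. -/
def diagBlocks (P Q : Matrix (Fin 3) (Fin 3) ℂ) : Matrix (Fin 6) (Fin 6) ℂ :=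
  (fromBlocks P 0 0 Q).reindex finSumFinEquiv finSumFinEquiv

theorem isUnit_det_diagBlocks {P Q : Matrix (Fin 3) (Fin 3) ℂ} (hP : IsUnit P.det)
    (hQ : IsUnit Q.det) : IsUnit (diagBlocks P Q).det := by
  rw [diagBlocks, det_reindex_self, det_fromBlocks_zero₂₁]
  exact hP.mul hQ

theorem diagBlocks_mul_hammer_mul (P Q X A : Matrix (Fin 3) (Fin 3) ℂ) :
    diagBlocks P Q * hammer X A * (diagBlocks P Q)ᵀ = hammer (P * X * Pᵀ) (P * A * Qᵀ) := by
  simp only [diagBlocks, hammer, reindex_apply, transpose_submatrix, submatrix_mul_equiv,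
    fromBlocks_transpose, fromBlocks_multiply]
  simp [Matrix.mul_assoc]

theorem det_eq_zero_of_det_hammer_eq_zero {X A : Matrix (Fin 3) (Fin 3) ℂ}
    (h : (hammer X A).det = 0) : A.det = 0 := by
  rw [hammer, det_reindex_self] at h
  have h1 : fromBlocks X A (-Aᵀ) 0 * fromBlocks 0 1 1 0 = fromBlocks A X 0 (-Aᵀ) := by
    simp [fromBlocks_multiply]
  have h2 := congrArg det h1
  rw [det_mul, h, zero_mul, det_fromBlocks_zero₂₁, det_neg, det_transpose] at h2
  simpa using h2

end Blocks

section Formats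

variable {V : Type*} [AddCommGroup V] [Module ℂ V]

theorem HasForm.evalAt_eq_hammer {N : Matrix (Fin 6) (Fin 6) (Dual ℂ V)} (hN : IsSkew N)
    (h : HasForm N hammerFormat) (v : V) :
    evalAt N v = hammer (of fun i j => N (Fin.castAdd 3 i) (Fin.castAdd 3 j) v)
      (of fun i j => N (Fin.castAdd 3 i) (Fin.natAdd 3 j) v) := by
  ext a b
  obtain ⟨i, rfl⟩ := (finSumFinEquiv (m := 3) (n := 3)).surjective a
  obtain ⟨j, rfl⟩ := (finSumFinEquiv (m := 3) (n := 3)).surjective b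
  rw [hammer, reindex_apply, submatrix_apply, Equiv.symm_apply_apply, Equiv.symm_apply_apply]
  rcases i with i | i <;> rcases j with j | j
  · rfl
  · rfl
  · have := congrFun (congrFun (hN.evalAt v) (Fin.castAdd 3 j))
      (Fin.natAdd 3 i)
    exact this.trans rfl
  · have : N (Fin.natAdd 3 i) (Fin.natAdd 3 j) = 0 := by
      refine h _ _ ?_
      fin_cases i <;> fin_cases j <;> rfl
    exact LinearMap.congr_fun this v

variable {N : Matrix (Fin 6) (Fin 6) (Dual ℂ V)} {X A : V → Matrix (Fin 3) (Fin 3) ℂ}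

theorem hasForm_formatA (hN : ∀ v, evalAt N v = hammer (X v) (A v)) (hX : ∀ v, (X v)ᵀ = -X v)
    (hA : ∀ v i, A v i 2 = 0) : HasForm N formatA := by
  intro i j h
  ext v
  have hX' : ∀ i, X v i i = 0 := fun i => by
    have : X v i i = -X v i i := congrFun (congrFun (hX v) i) i
    linear_combination (1 / 2 : ℂ) * this
  refine (congrFun (congrFun (hN v) i) j).trans ?_
  fin_cases i <;> fin_cases j <;> first
    | exact nomatch (show Slot.x = Slot.o from h)
    | exact hX' _
    | exact hA v _
    | exact neg_eq_zero.mpr (hA v _)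
    | rfl

theorem hasForm_formatB (hN : ∀ v, evalAt N v = hammer (X v) (A v)) (hX : ∀ v, (X v)ᵀ = -X v)
    (hA : ∀ v j, A v 2 j = 0) : HasForm N formatB := by
  intro i j h
  ext v
  have hX' : ∀ i, X v i i = 0 := fun i => by
    have : X v i i = -X v i i := congrFun (congrFun (hX v) i) i
    linear_combination (1 / 2 : ℂ) * this
  refine (congrFun (congrFun (hN v) i) j).trans ?_
  fin_cases i <;> fin_cases j <;> first
    | exact nomatch (show Slot.x = Slot.o from h)
    | exact hX' _
    | exact hA v _
    | exact neg_eq_zero.mpr (hA v _)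
    | rfl

theorem hasForm_formatC (hN : ∀ v, evalAt N v = hammer (X v) (A v)) (hX : ∀ v, (X v)ᵀ = -X v)
    (hA : ∀ v, A v 1 1 = 0 ∧ A v 1 2 = 0 ∧ A v 2 1 = 0 ∧ A v 2 2 = 0) : HasForm N formatC := by
  intro i j h
  ext v
  have hX' : ∀ i, X v i i = 0 := fun i => by
    have : X v i i = -X v i i := congrFun (congrFun (hX v) i) i
    linear_combination (1 / 2 : ℂ) * this
  obtain ⟨h11, h12, h21, h22⟩ := hA v
  refine (congrFun (congrFun (hN v) i) j).trans ?_
  fin_cases i <;> fin_cases j <;> first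
    | exact nomatch (show Slot.x = Slot.o from h)
    | exact hX' _
    | exact h11
    | exact h12
    | exact h21
    | exact h22
    | exact neg_eq_zero.mpr h11
    | exact neg_eq_zero.mpr h12
    | exact neg_eq_zero.mpr h21
    | exact neg_eq_zero.mpr h22
    | rfl

theorem hasForm_formatE (hN : ∀ v, evalAt N v = hammer (X v) (A v)) (hX : ∀ v, (X v)ᵀ = -X v)
    (hA : ∀ v, (A v)ᵀ = -A v) : HasForm N formatE := by
  intro i j h
  ext v
  have hdiag : ∀ {Y : Matrix (Fin 3) (Fin 3) ℂ}, Yᵀ = -Y → ∀ i, Y i i = 0 := fun {Y} hY i => by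
    have : Y i i = -Y i i := congrFun (congrFun hY i) i
    linear_combination (1 / 2 : ℂ) * this
  refine (congrFun (congrFun (hN v) i) j).trans ?_
  fin_cases i <;> fin_cases j <;> first
    | exact nomatch (show Slot.x = Slot.o from h)
    | exact hdiag (hX v) _
    | exact hdiag (hA v) _
    | exact neg_eq_zero.mpr (hdiag (hA v) _)
    | rfl

theorem isDoubleSkew_of_evalAt (hN : ∀ v, evalAt N v = hammer (X v) (A v))
    (hX : ∀ v, (X v)ᵀ = -X v) (hA : ∀ v, (A v)ᵀ = -A v) : IsDoubleSkew N := by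
  have hent : ∀ v i j, N (finSumFinEquiv (m := 3) (n := 3) i) (finSumFinEquiv (m := 3) (n := 3) j) v =
      fromBlocks (X v) (A v) (-(A v)ᵀ) 0 i j := fun v i j => by
    refine (congrFun (congrFun (hN v) (finSumFinEquiv i)) (finSumFinEquiv j)).trans ?_
    rw [hammer, reindex_apply, submatrix_apply, Equiv.symm_apply_apply, Equiv.symm_apply_apply]
  refine ⟨of fun i j => N (Fin.castAdd 3 i) (Fin.castAdd 3 j),
    of fun i j => N (Fin.castAdd 3 i) (Fin.natAdd 3 j), 0, ?_, ?_, ?_, ?_⟩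
  · ext i j v
    refine (hent v (Sum.inl j) (Sum.inl i)).trans ?_
    refine (congrFun (congrFun (hX v) i) j).trans ?_
    exact congrArg Neg.neg (hent v (Sum.inl i) (Sum.inl j)).symm
  · ext i j v
    refine (hent v (Sum.inl j) (Sum.inr i)).trans ?_
    refine (congrFun (congrFun (hA v) i) j).trans ?_
    exact congrArg Neg.neg (hent v (Sum.inl i) (Sum.inr j)).symm
  · simp [IsSkew]
  · ext a b v
    obtain ⟨i, rfl⟩ := (finSumFinEquiv (m := 3) (n := 3)).surjective a
    obtain ⟨j, rfl⟩ := (finSumFinEquiv (m := 3) (n := 3)).surjective b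
    rw [reindex_apply, submatrix_apply, Equiv.symm_apply_apply, Equiv.symm_apply_apply]
    rcases i with i | i <;> rcases j with j | j
    · rfl
    · rfl
    · refine (hent v (Sum.inr i) (Sum.inl j)).trans ?_
      exact congrArg Neg.neg (hent v (Sum.inl j) (Sum.inr i)).symm
    · exact hent v (Sum.inr i) (Sum.inr j)

end Formats

end SkewFormats

open Matrix SkewFormats in
theorem mainTheorem3 {V : Type*} [AddCommGroup V] [Module ℂ V] [FiniteDimensional ℂ V]
    (M : Matrix (Fin 6) (Fin 6) (Module.Dual ℂ V))
    (hskew : SkewFormats.IsSkew M)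
    (hhammer : SkewFormats.HasSkewFormat M SkewFormats.hammerFormat)
    (hpf : SkewFormats.formPfaffian M = 0) :
    SkewFormats.HasSkewFormat M SkewFormats.formatA ∨
    SkewFormats.HasSkewFormat M SkewFormats.formatB ∨
    SkewFormats.HasSkewFormat M SkewFormats.formatC ∨
    SkewFormats.HasDoubleSkewFormat M SkewFormats.formatE := by
  obtain ⟨-, S, hS⟩ := hhammer
  set N := congruent (S : Matrix (Fin 6) (Fin 6) ℂ) M with hN
  have hNskew : IsSkew N := isSkew_of_evalAt fun v => by
    rw [hN, evalAt_congruent, transpose_mul, transpose_mul, transpose_transpose, hskew.evalAt v]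
    simp [Matrix.mul_assoc]
  let A : V →ₗ[ℂ] Matrix (Fin 3) (Fin 3) ℂ :=
    { toFun := fun v => of fun i j => N (Fin.castAdd 3 i) (Fin.natAdd 3 j) v
      map_add' := fun v w => by ext i j; simp
      map_smul' := fun c v => by ext i j; simp }
  have hNA : ∀ v, evalAt N v = hammer _ (A v) := hS.evalAt_eq_hammer hNskew
  have hdet : ∀ v, (A v).det = 0 := fun v => by
    apply det_eq_zero_of_det_hammer_eq_zero
    rw [← hNA v, hN, evalAt_congruent, det_mul, det_mul, det_evalAt_eq_zero hskew hpf]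
    simp
  obtain ⟨P, Q, hP, hQ, hB⟩ := hasSingularNormalForm_of_det_eq_zero A hdet
  have hT : IsUnit (diagBlocks P Qᵀ * (S : Matrix (Fin 6) (Fin 6) ℂ)) :=
    ((isUnit_iff_isUnit_det _).mpr
      (isUnit_det_diagBlocks hP (by rwa [det_transpose]))).mul S.isUnit
  obtain ⟨T, hT⟩ := hT
  have hM' : ∀ v, evalAt (congruent (T : Matrix (Fin 6) (Fin 6) ℂ) M) v =
      hammer (P * (of fun i j => N (Fin.castAdd 3 i) (Fin.castAdd 3 j) v) * Pᵀ)
        (P * A v * Q) := fun v => by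
    conv_rhs => rw [← transpose_transpose Q]
    rw [← diagBlocks_mul_hammer_mul, ← hNA v, hN, evalAt_congruent, evalAt_congruent, hT,
      transpose_mul]
    simp only [Matrix.mul_assoc]
  have hX : ∀ v, (P * (of fun i j => N (Fin.castAdd 3 i) (Fin.castAdd 3 j) v) * Pᵀ)ᵀ =
      -(P * (of fun i j => N (Fin.castAdd 3 i) (Fin.castAdd 3 j) v) * Pᵀ) := fun v => by
    have : (of fun i j : Fin 3 => N (Fin.castAdd 3 i) (Fin.castAdd 3 j) v)ᵀ =
        -(of fun i j : Fin 3 => N (Fin.castAdd 3 i) (Fin.castAdd 3 j) v) := by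
      ext i j
      exact congrFun (congrFun (hNskew.evalAt v) _) _
    rw [transpose_mul, transpose_mul, transpose_transpose, this, Matrix.neg_mul,
      Matrix.mul_neg, Matrix.mul_assoc]
  rcases hB with h | h | h | h
  · exact Or.inl ⟨hskew, T, hasForm_formatA hM' hX h⟩
  · exact Or.inr (Or.inl ⟨hskew, T, hasForm_formatB hM' hX h⟩)
  · exact Or.inr (Or.inr (Or.inl ⟨hskew, T, hasForm_formatC hM' hX h⟩))
  · exact Or.inr (Or.inr (Or.inr ⟨hskew, T, isDoubleSkew_of_evalAt hM' hX h,
      hasForm_formatE hM' hX h⟩))
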